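/- For a finite group $R$ and $S\subseteq R\setminus\{1\}$, let $\mathrm{Cay}(R,S)$ be the Cayley digraph with vertex set $R$ and an arc from $x$ to $sx$ for all $x\in R$, $s\in S$. The group $R$ is a DCI-group if, whenever $\mathrm{Cay}(R,S)\cong\mathrm{Cay}(R,T)$ with $S,T\subseteq R\setminus\{1\}$, there is $a\in\mathrm{Aut}(R)$ with $T=S^a$. If a group $G$ acts on a finite set $\Omega$, let $\mathsf{o}(\Omega,G)$ be the number of $G$-orbits on $\Omega$, and for $x\in G$ let $\mathsf{c}(\Omega,x)$ be the number of cycles (including cycles of length $1$) of the permutation of $\Omega$ induced by $x$. Let $\mathrm{D}_{2n}=\langle u_n,v_n\mid u_n^n=v_n^2=1,\ v_nu_nv_n=u_n^{-1}\rangle$. For $r,t\in\mathbb{Z}$ with $\gcd(r,n)=1$ let $a_{n,r,t}\in\mathrm{Aut}(\mathrm{D}_{2n})$ be given by $u_n^i\mapsto u_n^{ri}$, $u_n^jv_n\mapsto u_n^{rj+t}v_n$; it depends only on $r$ and $t$ modulo $n$. Put $V_n=\{u_n^jv_n\mid 0\le j<n\}$ and $U_n=\langle u_n\rangle\setminus\{1\}$,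 the disjoint union over the divisors $d>1$ of $n$ of the sets $U_n(d)$ of elements of order $d$ in $\langle u_n\rangle$. Let $\phi$ be Euler's function, $|r|_d$ the multiplicative order of $r$ modulo $d$, $S_k(x)=1+x+\cdots+x^{k-1}$, and \[\kappa(m,r,t)=\frac{m|r|_m}{\gcd\left(m,\,tS_{|r|_m}(r)\right)}.\] **Theorem.** Assume that $n>2$ and that $\mathrm{D}_{2n}$ is a DCI-group. Then the number of non-isomorphic Cayley digraphs on $\mathrm{D}_{2n}$ is equal to \[\mathsf{o}\left(2^{\mathrm{D}_{2n}\setminus\{1\}},\mathrm{Aut}(\mathrm{D}_{2n})\right)=\frac{1}{n\phi(n)}\sum_{t>0,\ t\mid n}\phi\left(\frac nt\right)\sum_{r\in(\mathbb{Z}/n)^\times}2^{\mathsf{c}(U_n,a_{n,r,0})+\mathsf{c}(V_n,a_{n,r,t})},\] where, for all integers $r,t$ with $\gcd(r,n)=1$, \[\mathsf{c}(U_n,a_{n,r,0})=\sum_{d>1,\ d\mid n}\frac{\phi(d)}{|r|_d}\] and \[\mathsf{c}(V_n,a_{n,r,t})=\sum_{(d,\ell)}\frac{d}{\kappa(n,r,t)}\,\phi\left(\frac{|r|_n}{\ell\gcd(\kappa(d,r,t),|r|_n)}\right),\]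 the last sum running over all pairs of positive integers $(d,\ell)$ such that $d\mid n$, $\ell\mid\frac{|r|_n}{\gcd(\kappa(d,r,t),|r|_n)}$ and $\gcd\left(r^{\ell\kappa(d,r,t)}-1,n\right)=d$. -/

import Mathlib

open scoped Pointwise

namespace CayleyEnum

/-! ### Cayley digraphs, isomorphism, DCI-groups -/

/-- The Cayley digraph `Cay(R, S)`: vertices are the elements of `R`, and there is an arc from `x`
to `s * x` for every `x ∈ R` and every `s ∈ S`. -/
def cay {R : Type*} [Group R] (S : Set R) : Digraph R where
  Adj x y := ∃ s ∈ S, y = s * x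

/-- Isomorphism of digraphs: a bijection of the vertices that preserves and reflects arcs. -/
def DigraphIso {V W : Type*} (G : Digraph V) (H : Digraph W) : Prop :=
  Nonempty (G.Adj ≃r H.Adj)

/-- Connection sets: the subsets of `R \ {1}`, that is the power set of `R \ {1}`. -/
def connectionSets (R : Type*) [Group R] : Set (Set R) := 𝒫 ({1}ᶜ : Set R)

/-- `R` is a DCI-group: whenever two Cayley digraphs `Cay(R, S)` and `Cay(R, T)` are isomorphic,
some automorphism of the group `R` maps `S` onto `T`. -/
def IsDCIGroup (R : Type*) [Group R] : Prop :=
  ∀ S ∈ connectionSets R, ∀ T ∈ connectionSets R,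
    DigraphIso (cay S) (cay T) → ∃ a : MulAut R, T = a '' S

/-- The isomorphism relation of Cayley digraphs, as a relation on connection sets. -/
def cayIsoSetoid (R : Type*) [Group R] : Setoid (connectionSets R) where
  r S T := DigraphIso (cay S.1) (cay T.1)
  iseqv :=
    { refl := fun _ => ⟨RelIso.refl _⟩
      symm := fun ⟨e⟩ => ⟨e.symm⟩
      trans := fun ⟨e⟩ ⟨f⟩ => ⟨e.trans f⟩ }

/-- The number of non-isomorphic Cayley digraphs on the (finite) group `R`. -/
noncomputable def numCayleyDigraphs (R : Type*) [Group R] : ℕ :=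
  Nat.card (Quotient (cayIsoSetoid R))

/-! ### Orbit numbers and cycle numbers -/

/-- `𝗈(Ω, G)`: the number of `G`-orbits on `Ω`, for a finite `G`-invariant set `Ω`. -/
noncomputable def orbitNumber (G : Type*) [Group G] {X : Type*} [MulAction G X] (Ω : Set X) : ℕ :=
  {O : Set X | ∃ α ∈ Ω, O = MulAction.orbit G α}.ncard

/-- `𝖼(Ω, x)`: the cycle number (cycles of length one included) of the permutation that `x` induces
on the finite `x`-invariant set `Ω`, that is the number of orbits of `⟨x⟩` on `Ω`. -/
noncomputable def cycleNumber {G : Type*} [Group G] {X : Type*} [MulAction G X]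
    (Ω : Set X) (x : G) : ℕ :=
  orbitNumber (Subgroup.zpowers x) Ω

/-! ### The dihedral group and its automorphisms -/

open DihedralGroup

/-- The rotation `u_n`. -/
def u (n : ℕ) : DihedralGroup n := r 1

/-- The reflection `v_n`. -/
def v (n : ℕ) : DihedralGroup n := sr 0

lemma u_zpow (n : ℕ) (i : ℤ) : u n ^ i = r (i : ZMod n) := by
  simp [u]

lemma u_zpow_mul_v (n : ℕ) (j : ℤ) : u n ^ j * v n = sr (-(j : ZMod n)) := by
  rw [u_zpow]; simp [v]

/-- The automorphism `a_{n,q,t}` with `q` a unit modulo `n`; by `u_zpow_mul_v` the element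
`u_n ^ j * v_n` is `sr (-j)`, so this is `u_n ^ i ↦ u_n ^ (q i)`, `u_n ^ j v_n ↦ u_n ^ (q j + t) v_n`;
see `aut_u_zpow` and `aut_u_zpow_mul_v`. -/
def aut (n : ℕ) (q : (ZMod n)ˣ) (t : ZMod n) : MulAut (DihedralGroup n) where
  toFun
    | r i => r (q * i)
    | sr i => sr (q * i - t)
  invFun
    | r i => r ((q⁻¹ : (ZMod n)ˣ) * i)
    | sr i => sr ((q⁻¹ : (ZMod n)ˣ) * (i + t))
  left_inv := by rintro (i | i) <;> simp
  right_inv := by rintro (i | i) <;> simp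
  map_mul' := by
    rintro (i | i) (j | j) <;> simp <;> ring

lemma aut_u_zpow (n : ℕ) (q t : ℤ) (hq : IsCoprime q (n : ℤ)) (i : ℤ) :
    aut n (ZMod.unitOfIsCoprime q hq) t (u n ^ i) = u n ^ (q * i) := by
  rw [u_zpow, u_zpow]; simp [aut]

lemma aut_u_zpow_mul_v (n : ℕ) (q t : ℤ) (hq : IsCoprime q (n : ℤ)) (j : ℤ) :
    aut n (ZMod.unitOfIsCoprime q hq) t (u n ^ j * v n) = u n ^ (q * j + t) * v n := by
  rw [u_zpow_mul_v, u_zpow_mul_v]; simp [aut]; ring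

/-- `U_n(d)`: the elements of order `d` in `⟨u_n⟩`. -/
def Ud (n d : ℕ) : Set (DihedralGroup n) := {g | g ∈ Subgroup.zpowers (u n) ∧ orderOf g = d}

/-- `U_n`: the union of the sets `U_n(d)` over the divisors `d > 1` of `n`. -/
def U (n : ℕ) : Set (DihedralGroup n) := {g | ∃ d, 1 < d ∧ d ∣ n ∧ g ∈ Ud n d}

/-- `V_n = {v_n, u_n v_n, …, u_n ^ (n - 1) v_n}`. -/
def V (n : ℕ) : Set (DihedralGroup n) := {g | ∃ j : ℕ, j < n ∧ g = u n ^ j * v n}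

/-! ### The arithmetic functions in the explicit cycle numbers -/

/-- `|q|_n`: the multiplicative order of `q` modulo `n` (for `q` coprime to `n`). -/
noncomputable def ordMod (q : ℤ) (n : ℕ) : ℕ := orderOf (q : ZMod n)

/-- `S_k(x) = 1 + x + ⋯ + x ^ (k - 1)`, with `S_0(x) = 0`. -/
def geomS (k : ℕ) (x : ℤ) : ℤ := ∑ i ∈ Finset.range k, x ^ i

/-- `κ(n, q, t) = n |q|_n / gcd(n, t S_{|q|_n}(q))`; the division is exact. -/
noncomputable def kappa (n : ℕ) (q t : ℤ) : ℕ :=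
  n * ordMod q n / Int.gcd n (t * geomS (ordMod q n) q)

/-- The sum `∑_{d ∣ n, d > 1} φ(d) / |q|_d`. -/
noncomputable def cUFormula (n : ℕ) (q : ℤ) : ℚ :=
  ∑ d ∈ n.divisors with 1 < d, (d.totient : ℚ) / ordMod q d

/-- The sum of `(d / κ(n,q,t)) φ(|q|_n / (ℓ gcd(κ(d,q,t), |q|_n)))` over all pairs `(d, ℓ)` such that
`d ∣ n`, `ℓ ∣ |q|_n / gcd(κ(d,q,t), |q|_n)` and `gcd(q ^ (ℓ κ(d,q,t)) - 1, n) = d`;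
all the divisions inside `φ` and in the condition on `ℓ` are exact. -/
noncomputable def cVFormula (n : ℕ) (q t : ℤ) : ℚ :=
  ∑ d ∈ n.divisors,
    ∑ l ∈ (ordMod q n / Nat.gcd (kappa d q t) (ordMod q n)).divisors with
        Int.gcd (q ^ (l * kappa d q t) - 1) n = d,
      (d : ℚ) / kappa n q t *
        (Nat.totient (ordMod q n / (l * Nat.gcd (kappa d q t) (ordMod q n))) : ℚ)

end CayleyEnum

/-! Automorphisms always give isomorphic Cayley digraphs, and the DCI property is the converse, so
isomorphism classes are `Aut`-orbits on connection sets. The orbit-counting lemma applies, and a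
subset fixed by `a` is a union of cycles of `a`, which gives `2 ^ cycleNumber`
(`ncard_fixed_subsets`).

For `n > 2` every automorphism is a unique `aut n q t` (`autEquiv`), so `|Aut| = n φ(n)`. On
rotations it is multiplication by `q`, whatever `t` is; on reflections it is an affine map mod `n`.
Conjugating by `aut n w 0` replaces `t` by `w t`, so only `gcd(t, n)` matters, and each divisor `t`
of `n` stands for `φ(n/t)` translations.

A rotation of order `d` lies in a cycle of length `|q|_d`, which settles `U n`. On `V n`, the `k`-th
power fixes the solutions of `(q^k - 1) i = t S_k(q)` mod `n`. With `d = gcd(q^k - 1, n)` there are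
`d` of them if `κ(d) ∣ k`, and otherwise none (`ncard_fixed_V`), because `κ(d)` is the order of the
affine map mod `d`. Averaging over `k < κ(n)`, it remains to count, for each `d`, the multiples `k =
j κ(d)` with this gcd. If any exist, then `κ(n) = lcm(κ(d), |q|_n) = N κ(d)` with `N = |q|_n /
gcd(κ(d), |q|_n)` (`kappa_eq_lcm`), and the gcd depends only on `ℓ = gcd(j, N)`, a value taken
`φ(N/ℓ)` times (`card_exponents_eq`). -/

namespace CayleyEnum

/-! ### Orbit counting and invariant subsets -/

section Orbits

variable {G : Type*} [Group G] {X : Type*} [MulAction G X]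

lemma smul_mem_of_zpowers {x : G} {Ω : Set X} (hΩ : ∀ α, x • α ∈ Ω ↔ α ∈ Ω)
    (g : Subgroup.zpowers x) (α : X) (hα : α ∈ Ω) : g • α ∈ Ω := by
  obtain ⟨g, k, rfl⟩ := g
  change x ^ k • α ∈ Ω
  have hinv : ∀ α, x⁻¹ • α ∈ Ω ↔ α ∈ Ω := fun α => by
    rw [← hΩ (x⁻¹ • α), smul_inv_smul]
  induction k using Int.induction_on generalizing α with
  | zero => simpa using hα
  | succ i ih => rw [zpow_add_one, mul_smul]; exact ih _ ((hΩ α).2 hα)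
  | pred i ih => rw [zpow_sub_one, mul_smul]; exact ih _ ((hinv α).2 hα)

/-- The orbits that meet `Ω`. -/
def orbitSet (G : Type*) [Group G] {X : Type*} [MulAction G X] (Ω : Set X) : Set (Set X) :=
  {O : Set X | ∃ α ∈ Ω, O = MulAction.orbit G α}

lemma orbitNumber_eq_ncard (Ω : Set X) : orbitNumber G Ω = (orbitSet G Ω).ncard := rfl

lemma orbit_subset_of_invariant {Ω : Set X} (hΩ : ∀ g : G, ∀ α ∈ Ω, g • α ∈ Ω) {α : X}
    (hα : α ∈ Ω) : MulAction.orbit G α ⊆ Ω := by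
  rintro _ ⟨g, rfl⟩
  exact hΩ g α hα

lemma orbitNumber_union [Finite X] {Ω Λ : Set X} (hΩ : ∀ g : G, ∀ α ∈ Ω, g • α ∈ Ω)
    (hd : Disjoint Ω Λ) : orbitNumber G (Ω ∪ Λ) = orbitNumber G Ω + orbitNumber G Λ := by
  simp only [orbitNumber_eq_ncard]
  have : orbitSet G (Ω ∪ Λ) = orbitSet G Ω ∪ orbitSet G Λ := by
    ext O
    simp only [orbitSet, Set.mem_union, Set.mem_ofPred_eq, or_and_right, exists_or]
  rw [this]
  refine Set.ncard_union_eq ?_ (Set.toFinite _) (Set.toFinite _)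
  rw [Set.disjoint_left]
  rintro _ ⟨α, hα, rfl⟩ ⟨β, hβ, h⟩
  have : β ∈ MulAction.orbit G α := h ▸ MulAction.mem_orbit_self β
  exact Set.disjoint_left.1 hd (orbit_subset_of_invariant hΩ hα this) hβ

/-- The weights `1 / |orbit|` add up to `1` over each orbit. -/
lemma orbitNumber_eq_sum [Finite X] (Ω : Finset X) (hΩ : ∀ g : G, ∀ α ∈ Ω, g • α ∈ Ω) :
    (orbitNumber G (Ω : Set X) : ℚ) = ∑ α ∈ Ω, (1 : ℚ) / (MulAction.orbit G α).ncard := by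
  classical
  have himg : orbitSet G (Ω : Set X) = ((Ω.image fun α => MulAction.orbit G α : Finset (Set X)) :
      Set (Set X)) := by
    ext O
    simp [orbitSet, eq_comm]
  rw [orbitNumber_eq_ncard, himg, Set.ncard_coe_finset,
    ← Finset.sum_fiberwise_of_maps_to (t := Ω.image fun α => MulAction.orbit G α)
      (g := fun α => MulAction.orbit G α) (fun α hα => Finset.mem_image_of_mem _ hα),
    Finset.card_eq_sum_ones, Nat.cast_sum]
  refine Finset.sum_congr rfl fun O hO => ?_
  obtain ⟨α, hα, rfl⟩ := Finset.mem_image.1 hO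
  have hfib : ((Ω.filter fun β => MulAction.orbit G β = MulAction.orbit G α : Finset X) : Set X) =
      MulAction.orbit G α := by
    ext β
    simp only [Finset.coe_filter, Set.mem_ofPred_eq, MulAction.orbit_eq_iff]
    refine ⟨fun h => h.2, fun h => ⟨?_, h⟩⟩
    exact orbit_subset_of_invariant (Ω := (Ω : Set X)) hΩ hα h
  have hcard := congrArg Set.ncard hfib
  rw [Set.ncard_coe_finset] at hcard
  rw [Finset.sum_congr rfl (g := fun _ => (1 : ℚ) / (MulAction.orbit G α).ncard)
    (fun β hβ => by rw [(Finset.mem_filter.1 hβ).2]), Finset.sum_const, hcard, nsmul_eq_mul]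
  have : (MulAction.orbit G α).ncard ≠ 0 :=
    (Set.ncard_pos (Set.toFinite _)).2 (MulAction.nonempty_orbit α) |>.ne'
  have : ((MulAction.orbit G α).ncard : ℚ) ≠ 0 := by exact_mod_cast this
  field_simp
  simp

lemma ncard_orbit_mul_card_stabilizer (α : X) :
    (MulAction.orbit G α).ncard * Nat.card (MulAction.stabilizer G α) = Nat.card G := by
  rw [← Nat.card_coe_set_eq, ← Nat.card_prod]
  exact Nat.card_congr (MulAction.orbitProdStabilizerEquivGroup G α)

/-- The orbit-counting lemma on a finite invariant subset. -/
lemma orbitNumber_mul_card [Fintype G] [Finite X] (Ω : Finset X)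
    (hΩ : ∀ g : G, ∀ α ∈ Ω, g • α ∈ Ω) :
    (orbitNumber G (Ω : Set X) : ℚ) * Fintype.card G =
      ∑ g : G, (({α | α ∈ Ω ∧ g • α = α} : Set X).ncard : ℚ) := by
  classical
  rw [orbitNumber_eq_sum Ω hΩ, Finset.sum_mul]
  have h1 : ∀ g : G, (({α | α ∈ Ω ∧ g • α = α} : Set X).ncard : ℚ) =
      ∑ α ∈ Ω, if g • α = α then (1 : ℚ) else 0 := fun g => by
    rw [Finset.sum_boole, ← Set.ncard_coe_finset, Finset.coe_filter]
  simp_rw [h1]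
  -- Double counting of pairs `(g, α)` with `g • α = α`: each `α` contributes `|Stab α| = |G| /
  -- |orbit α|`.
  rw [Finset.sum_comm]
  refine Finset.sum_congr rfl fun α _ => ?_
  have h2 : ((MulAction.orbit G α).ncard : ℚ) ≠ 0 := by
    exact_mod_cast ((Set.ncard_pos (Set.toFinite _)).2 (MulAction.nonempty_orbit α)).ne'
  rw [Finset.sum_boole, ← Nat.card_eq_fintype_card, ← ncard_orbit_mul_card_stabilizer α]
  have h3 : Nat.card (MulAction.stabilizer G α) = (Finset.univ.filter fun g : G => g • α = α).card := by
    exact Nat.subtype_card _ (by simp)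
  rw [h3]
  push_cast
  field_simp

lemma image_orbit_subset {x : G} {S : Set X} (hS : x • S = S) {α : X} (hα : α ∈ S) :
    MulAction.orbit (Subgroup.zpowers x) α ⊆ S :=
  orbit_subset_of_invariant (smul_mem_of_zpowers fun β => by
    conv_lhs => rw [← hS]
    exact Set.smul_mem_smul_set_iff) hα

/-- The subsets of `Ω` fixed by `x` are the unions of cycles of `x` on `Ω`. -/
lemma ncard_fixed_subsets [Finite X] (x : G) (Ω : Set X) (hΩ : ∀ α, x • α ∈ Ω ↔ α ∈ Ω) :
    {S : Set X | S ∈ 𝒫 Ω ∧ x • S = S}.ncard = 2 ^ cycleNumber Ω x := by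
  rw [cycleNumber, orbitNumber_eq_ncard, ← Set.ncard_powerset _ (Set.toFinite _)]
  -- A fixed subset corresponds to the set of cycles it contains; the inverse map is the union.
  refine Set.ncard_congr (fun S _ => orbitSet (Subgroup.zpowers x) S) ?_ ?_ ?_
  · rintro S ⟨hS, -⟩ _ ⟨α, hα, rfl⟩
    exact ⟨α, hS hα, rfl⟩
  · have key : ∀ S T : Set X, x • T = T →
        orbitSet (Subgroup.zpowers x) S = orbitSet (Subgroup.zpowers x) T → S ⊆ T := by
      intro S T hT h α hα
      obtain ⟨β, hβ, hO⟩ : MulAction.orbit (Subgroup.zpowers x) α ∈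
        orbitSet (Subgroup.zpowers x) T := h ▸ ⟨α, hα, rfl⟩
      exact image_orbit_subset hT hβ (hO ▸ MulAction.mem_orbit_self α)
    rintro S T ⟨-, hS⟩ ⟨-, hT⟩ h
    exact (key S T hT h).antisymm (key T S hS h.symm)
  · intro P hP
    refine ⟨⋃₀ P, ⟨?_, ?_⟩, ?_⟩
    · rintro α ⟨O, hO, hα⟩
      obtain ⟨β, hβ, rfl⟩ := hP hO
      exact orbit_subset_of_invariant (smul_mem_of_zpowers hΩ) hβ hα
    · ext α
      rw [Set.mem_smul_set_iff_inv_smul_mem]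
      simp only [Set.mem_sUnion]
      refine exists_congr fun O => and_congr_right fun hO => ?_
      obtain ⟨β, hβ, rfl⟩ := hP hO
      rw [← MulAction.orbit_eq_iff, ← MulAction.orbit_eq_iff]
      exact iff_of_eq (congrArg (· = MulAction.orbit (Subgroup.zpowers x) β)
        (MulAction.orbit_smul (⟨x, Subgroup.mem_zpowers x⟩ : Subgroup.zpowers x)⁻¹ α))
    · ext O
      constructor
      · rintro ⟨α, ⟨O', hO', hα⟩, rfl⟩
        obtain ⟨β, hβ, rfl⟩ := hP hO'
        rwa [MulAction.orbit_eq_iff.2 hα]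
      · intro hO
        obtain ⟨β, hβ, rfl⟩ := hP hO
        exact ⟨β, ⟨_, hO, MulAction.mem_orbit_self β⟩, rfl⟩

lemma ncard_orbit_zpowers [Finite X] (x : G) (α : X) :
    (MulAction.orbit (Subgroup.zpowers x) α).ncard = Function.minimalPeriod (x • ·) α := by
  have : Fintype (MulAction.orbit (Subgroup.zpowers x) α) := Fintype.ofFinite _
  rw [MulAction.minimalPeriod_eq_card, ← Nat.card_coe_set_eq, Nat.card_eq_fintype_card]

/-- Orbit counting for a cyclic group, as a sum over the exponents. -/
lemma cycleNumber_mul_orderOf [Finite G] [Finite X] (x : G) (Ω : Finset X)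
    (hΩ : ∀ α, x • α ∈ Ω ↔ α ∈ Ω) :
    (cycleNumber (Ω : Set X) x : ℚ) * orderOf x =
      ∑ k ∈ Finset.range (orderOf x), (({α | α ∈ Ω ∧ x ^ k • α = α} : Set X).ncard : ℚ) := by
  have : Fintype (Subgroup.zpowers x) := Fintype.ofFinite _
  have h := orbitNumber_mul_card (G := Subgroup.zpowers x) Ω
    (smul_mem_of_zpowers (Ω := (Ω : Set X)) hΩ)
  rw [← Nat.card_eq_fintype_card, Nat.card_zpowers] at h
  rw [cycleNumber, h, Finset.sum_range]
  refine (Fintype.sum_equiv (finEquivZPowers (isOfFinOrder_of_finite x)) _ _ fun k => ?_).symm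
  rw [finEquivZPowers_apply]
  rfl

end Orbits

open DihedralGroup

/-! ### The affine description of the automorphisms of the dihedral group -/

section Aut

variable {n : ℕ}

@[simp] lemma aut_r (q : (ZMod n)ˣ) (t i : ZMod n) : aut n q t (r i) = r ((q : ZMod n) * i) := rfl

@[simp] lemma aut_sr (q : (ZMod n)ˣ) (t i : ZMod n) : aut n q t (sr i) = sr ((q : ZMod n) * i - t) := rfl

lemma r_injective : Function.Injective (r : ZMod n → DihedralGroup n) := fun _ _ h => r.inj h

lemma aut_mul (q q' : (ZMod n)ˣ) (t t' : ZMod n) :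
    aut n q t * aut n q' t' = aut n (q * q') (q * t' + t) := by
  ext (i | i)
  · simp [mul_assoc]
  · simp [mul_assoc]
    ring

lemma aut_one : aut n 1 0 = 1 := by
  ext (i | i) <;> simp

lemma aut_pow (q : (ZMod n)ˣ) (t : ZMod n) (k : ℕ) :
    aut n q t ^ k = aut n (q ^ k) (t * ∑ i ∈ Finset.range k, (q : ZMod n) ^ i) := by
  induction k with
  | zero => simp [aut_one]
  | succ k ih =>
    rw [pow_succ, ih, aut_mul, pow_succ, Finset.sum_range_succ]
    congr 1
    push_cast
    ring

lemma aut_injective : Function.Injective fun p : (ZMod n)ˣ × ZMod n => aut n p.1 p.2 := by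
  rintro ⟨q, t⟩ ⟨q', t'⟩ h
  have h1 := DFunLike.congr_fun h (r 1)
  have h2 := DFunLike.congr_fun h (sr 0)
  simp only [aut_r, aut_sr, r.injEq, sr.injEq, mul_one, mul_zero, zero_sub, neg_inj] at h1 h2
  rw [Units.ext h1, h2]

lemma aut_eq_one_iff {q : (ZMod n)ˣ} {t : ZMod n} : aut n q t = 1 ↔ q = 1 ∧ t = 0 := by
  rw [← aut_one]
  refine ⟨fun h => ?_, by rintro ⟨rfl, rfl⟩; rfl⟩
  exact Prod.mk.inj (aut_injective (a₁ := (q, t)) (a₂ := (1, 0)) h)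

lemma aut_surjective (hn : 2 < n) :
    Function.Surjective fun p : (ZMod n)ˣ × ZMod n => aut n p.1 p.2 := by
  intro f
  have : NeZero n := ⟨by omega⟩
  -- As `n ≠ 2`, an element of order `n` is not a reflection. As `n ∤ 2`, the image of `sr 0` is not
  -- a rotation either, since it would commute with the rotation `f (r 1)`.
  have hord : orderOf (f (r 1)) = n := by
    rw [MulEquiv.orderOf_eq, orderOf_r_one]
  obtain ⟨q, hq⟩ : ∃ q, f (r 1) = r q := by
    rcases h : f (r 1) with i | i
    · exact ⟨i, rfl⟩
    · rw [h, orderOf_sr] at hord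
      omega
  obtain ⟨t, ht⟩ : ∃ t, f (sr 0) = sr t := by
    rcases h : f (sr 0) with i | i
    · have hc : f (r 1 * sr 0) = f (sr 0 * r 1) := by
        rw [map_mul, map_mul, hq, h, r_mul_r, r_mul_r, add_comm]
      have hc := f.injective hc
      simp only [r_mul_sr, sr_mul_r, sr.injEq, zero_sub, zero_add] at hc
      have h2 : ((2 : ℕ) : ZMod n) = 0 := by
        push_cast
        linear_combination -hc
      rw [ZMod.natCast_eq_zero_iff] at h2
      exact absurd (Nat.le_of_dvd two_pos h2) (by omega)
    · exact ⟨i, rfl⟩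
  have hr : ∀ i : ZMod n, f (r i) = r (q * i) := fun i => by
    have h : (r i : DihedralGroup n) = r 1 ^ i.val := by simp
    rw [h, map_pow, hq, r_pow, ZMod.natCast_zmod_val]
  have hu : IsUnit q := by
    obtain ⟨x, hx⟩ := f.surjective (r 1)
    rcases x with i | i
    · rw [hr, r.injEq] at hx
      exact IsUnit.of_mul_eq_one _ hx
    · have := congrArg orderOf hx
      rw [MulEquiv.orderOf_eq, orderOf_sr, orderOf_r_one] at this
      omega
  -- The sign compensates for `aut` subtracting `t` from the index of `sr`.
  refine ⟨(hu.unit, -t), ?_⟩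
  ext (i | i)
  · simp [hr]
  · have h : (sr i : DihedralGroup n) = sr 0 * r i := by simp
    rw [h, map_mul f, ht, hr]
    simp [add_comm]

/-- The parametrization of `Aut(D_{2n})`. -/
noncomputable def autEquiv (hn : 2 < n) : (ZMod n)ˣ × ZMod n ≃ MulAut (DihedralGroup n) :=
  Equiv.ofBijective _ ⟨aut_injective, aut_surjective hn⟩

lemma autEquiv_apply (hn : 2 < n) (p : (ZMod n)ˣ × ZMod n) :
    autEquiv hn p = aut n p.1 p.2 := rfl

lemma mem_V_iff [NeZero n] {g : DihedralGroup n} : g ∈ V n ↔ ∃ i, g = sr i := by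
  constructor
  · rintro ⟨j, -, rfl⟩
    exact ⟨_, by rw [← zpow_natCast, u_zpow_mul_v]⟩
  · rintro ⟨i, rfl⟩
    refine ⟨(-i).val, ZMod.val_lt _, ?_⟩
    rw [← zpow_natCast, u_zpow_mul_v]
    simp

lemma mem_zpowers_u_iff {g : DihedralGroup n} : g ∈ Subgroup.zpowers (u n) ↔ ∃ i, g = r i := by
  constructor
  · rintro ⟨k, rfl⟩
    exact ⟨_, u_zpow n k⟩
  · rintro ⟨i, rfl⟩
    obtain ⟨k, rfl⟩ := ZMod.intCast_surjective i
    exact ⟨k, u_zpow n k⟩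

lemma orderOf_r_eq_addOrderOf (i : ZMod n) : orderOf (r i) = addOrderOf i := by
  rw [← orderOf_ofAdd_eq_addOrderOf]
  let f : Multiplicative (ZMod n) →* DihedralGroup n :=
    { toFun := fun x => r x.toAdd
      map_one' := rfl
      map_mul' := fun x y => (r_mul_r _ _).symm }
  exact orderOf_injective f (fun x y h => r.inj h) (Multiplicative.ofAdd i)

lemma mem_U_iff [NeZero n] {g : DihedralGroup n} : g ∈ U n ↔ ∃ i, i ≠ 0 ∧ g = r i := by
  constructor
  · rintro ⟨d, hd, -, hg, rfl⟩
    obtain ⟨i, rfl⟩ := mem_zpowers_u_iff.1 hg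
    refine ⟨i, ?_, rfl⟩
    rintro rfl
    simp at hd
  · rintro ⟨i, hi, rfl⟩
    refine ⟨_, ?_, ?_, mem_zpowers_u_iff.2 ⟨i, rfl⟩, rfl⟩
    · have h0 := orderOf_pos (r i : DihedralGroup n)
      have h1 : orderOf (r i : DihedralGroup n) ≠ 1 := by
        rw [Ne, orderOf_eq_one_iff, one_def, r.injEq]
        exact hi
      omega
    · rw [orderOf_r_eq_addOrderOf]
      simpa using addOrderOf_dvd_card (x := i)

lemma U_union_V [NeZero n] : U n ∪ V n = {1}ᶜ := by
  ext (i | i) <;> simp [mem_U_iff, mem_V_iff, one_def, -r_zero]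

lemma disjoint_U_V [NeZero n] : Disjoint (U n) (V n) := by
  rw [Set.disjoint_left]
  rintro (i | i) <;> simp [mem_U_iff, mem_V_iff]

lemma aut_smul_mem_U [NeZero n] (q : (ZMod n)ˣ) (t : ZMod n) (g : DihedralGroup n) :
    aut n q t • g ∈ U n ↔ g ∈ U n := by
  rcases g with i | i <;> simp [mem_U_iff, MulAut.smul_def]

lemma aut_smul_mem_V [NeZero n] (q : (ZMod n)ˣ) (t : ZMod n) (g : DihedralGroup n) :
    aut n q t • g ∈ V n ↔ g ∈ V n := by
  rcases g with i | i <;> simp [mem_V_iff, MulAut.smul_def]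

end Aut

/-! ### Isomorphism classes as automorphism orbits -/

section Isomorphism

lemma digraphIso_of_aut {R : Type*} [Group R] (S : Set R) (a : MulAut R) :
    DigraphIso (cay S) (cay (a '' S)) := by
  refine ⟨⟨a.toEquiv, fun {x y} => ?_⟩⟩
  simp only [cay, MulEquiv.toEquiv_eq_coe, EquivLike.coe_coe, Set.exists_mem_image]
  refine exists_congr fun s => and_congr_right fun _ => ?_
  rw [← map_mul, a.injective.eq_iff]

lemma smul_mem_connectionSets {R : Type*} [Group R] (a : MulAut R) {S : Set R}
    (hS : S ∈ connectionSets R) : a • S ∈ connectionSets R := by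
  rintro _ ⟨s, hs, rfl⟩
  have : s ≠ 1 := hS hs
  simpa [MulAut.smul_def] using this

/-- On a DCI-group, isomorphism classes of Cayley digraphs correspond to orbits of the automorphism
group on the connection sets. -/
lemma numCayleyDigraphs_eq_orbitNumber {R : Type*} [Group R] (h : IsDCIGroup R) :
    numCayleyDigraphs R = orbitNumber (MulAut R) (connectionSets R) := by
  rw [numCayleyDigraphs, orbitNumber_eq_ncard, ← Nat.card_coe_set_eq]
  have key : ∀ S T : connectionSets R, DigraphIso (cay S.1) (cay T.1) ↔
      MulAction.orbit (MulAut R) S.1 = MulAction.orbit (MulAut R) T.1 := fun S T => by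
    rw [eq_comm, MulAction.orbit_eq_iff]
    refine ⟨fun hST => ?_, ?_⟩
    · obtain ⟨a, ha⟩ := h S.1 S.2 T.1 T.2 hST
      exact ⟨a, ha.symm⟩
    · rintro ⟨a, ha⟩
      have ha : a '' S.1 = T.1 := ha
      exact ha ▸ digraphIso_of_aut S.1 a
  refine Nat.card_congr (Equiv.ofBijective
    (Quotient.lift (s := cayIsoSetoid R)
      (fun S => (⟨MulAction.orbit (MulAut R) S.1, S.1, S.2, rfl⟩ :
        orbitSet (MulAut R) (connectionSets R)))
      fun S T hST => Subtype.ext ((key S T).1 hST)) ⟨?_, ?_⟩)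
  · rintro ⟨S⟩ ⟨T⟩ hST
    exact Quotient.sound ((key S T).2 (congrArg Subtype.val hST))
  · rintro ⟨_, S, hS, rfl⟩
    exact ⟨Quotient.mk _ ⟨S, hS⟩, rfl⟩

end Isomorphism

/-! ### Cycles on rotations, and the sum over translations -/

lemma cycleNumber_conj {G : Type*} [Group G] [Finite G] {X : Type*} [MulAction G X] [Finite X]
    (a b : G) (Ω : Set X) (ha : ∀ α, a • α ∈ Ω ↔ α ∈ Ω) (hb : ∀ α, b • α ∈ Ω ↔ α ∈ Ω) :
    cycleNumber Ω (b * a * b⁻¹) = cycleNumber Ω a := by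
  have hb' : ∀ α, b⁻¹ • α ∈ Ω ↔ α ∈ Ω := fun α => by rw [← hb (b⁻¹ • α), smul_inv_smul]
  have hord : orderOf (b * a * b⁻¹) = orderOf a := by
    simpa [MulAut.conj_apply] using MulEquiv.orderOf_eq (MulAut.conj b) a
  have h1 := cycleNumber_mul_orderOf a (Set.toFinite Ω).toFinset (by simpa using ha)
  have h2 := cycleNumber_mul_orderOf (b * a * b⁻¹) (Set.toFinite Ω).toFinset
    (fun α => by simp [mul_smul, ha, hb, hb'])
  rw [Set.Finite.coe_toFinset] at h1 h2
  have h0 : (orderOf a : ℚ) ≠ 0 := by exact_mod_cast (orderOf_pos a).ne'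
  have h3 : (cycleNumber Ω (b * a * b⁻¹) : ℚ) = cycleNumber Ω a := by
    refine mul_right_cancel₀ h0 ?_
    rw [h1, ← hord, h2]
    refine Finset.sum_congr rfl fun k _ => ?_
    congr 1
    rw [conj_pow]
    -- Translation by `b⁻¹` carries the fixed points of `b * a ^ k * b⁻¹` to those of `a ^ k`.
    refine Set.ncard_congr (fun α _ => b⁻¹ • α) ?_ ?_ ?_
    · rintro α ⟨h, hα⟩
      refine ⟨by simpa [hb'] using h, ?_⟩
      conv_rhs => rw [← hα]
      simp [mul_smul]
    · rintro α β - - h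
      exact smul_left_cancel _ h
    · rintro α ⟨h, hα⟩
      exact ⟨b • α, ⟨by simpa [hb] using h, by simp [mul_smul, hα]⟩, by simp⟩
  exact_mod_cast h3

/-- `q ^ k * i = i` holds exactly when the additive order of `i` divides `q ^ k - 1`. -/
lemma minimalPeriod_aut_r {n : ℕ} (q : ℤ) (hq : IsCoprime q (n : ℤ)) (t i : ZMod n) :
    Function.minimalPeriod (aut n (ZMod.unitOfIsCoprime q hq) t • ·) (r i : DihedralGroup n) =
      ordMod q (addOrderOf i) := by
  refine Nat.dvd_right_iff_eq.1 fun k => ?_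
  rw [← MulAction.pow_smul_eq_iff_minimalPeriod_dvd, aut_pow, MulAut.smul_def, aut_r, r.injEq,
    ordMod, orderOf_dvd_iff_pow_eq_one]
  have h1 : (q : ZMod (addOrderOf i)) ^ k = 1 ↔ (((q ^ k - 1 : ℤ)) : ZMod (addOrderOf i)) = 0 := by
    push_cast
    rw [sub_eq_zero]
  rw [h1, ZMod.intCast_zmod_eq_zero_iff_dvd, addOrderOf_dvd_iff_zsmul_eq_zero, zsmul_eq_mul]
  push_cast
  rw [sub_mul, one_mul, sub_eq_zero, ZMod.coe_unitOfIsCoprime]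

section

variable {n : ℕ} [NeZero n]

lemma cycleNumber_U (q : ℤ) (hq : IsCoprime q (n : ℤ)) (t : ZMod n) :
    (cycleNumber (U n) (aut n (ZMod.unitOfIsCoprime q hq) t) : ℚ) = cUFormula n q := by
  classical
  have h := orbitNumber_eq_sum (G := Subgroup.zpowers (aut n (ZMod.unitOfIsCoprime q hq) t))
    (Set.toFinite (U n)).toFinset (fun g α hα => by
      rw [Set.Finite.mem_toFinset] at hα ⊢
      exact smul_mem_of_zpowers (aut_smul_mem_U _ t) g α hα)
  rw [Set.Finite.coe_toFinset] at h
  have hU : (Set.toFinite (U n)).toFinset =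
      (Finset.univ.filter fun i : ZMod n => i ≠ 0).map ⟨r, r_injective⟩ := by
    ext g
    simp only [Set.Finite.mem_toFinset, mem_U_iff, Finset.mem_map, Finset.mem_filter,
      Finset.mem_univ, true_and, Function.Embedding.coeFn_mk, eq_comm (a := g)]
  rw [cycleNumber, h, hU, Finset.sum_map]
  simp only [Function.Embedding.coeFn_mk, ncard_orbit_zpowers, minimalPeriod_aut_r]
  rw [cUFormula, ← Finset.sum_fiberwise_of_maps_to
    (t := n.divisors.filter fun d => 1 < d) (g := fun i : ZMod n => addOrderOf i)]
  · refine Finset.sum_congr rfl fun d hd => ?_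
    rw [Finset.mem_filter, Nat.mem_divisors] at hd
    have hcard : ((Finset.univ.filter fun i : ZMod n => i ≠ 0).filter
        fun i => addOrderOf i = d).card = d.totient := by
      rw [← IsAddCyclic.card_addOrderOf_eq_totient (α := ZMod n) (d := d)
        (by rw [ZMod.card]; exact hd.1.1), Finset.filter_filter]
      congr 1
      ext i
      simp only [Finset.mem_filter, Finset.mem_univ, true_and, and_iff_right_iff_imp]
      rintro rfl rfl
      simp at hd
    rw [Finset.sum_congr rfl (g := fun _ => (1 : ℚ) / ordMod q d)
      (fun i hi => by rw [(Finset.mem_filter.1 hi).2]), Finset.sum_const, hcard, nsmul_eq_mul]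
    ring
  · intro i hi
    rw [Finset.mem_filter, Nat.mem_divisors]
    refine ⟨⟨?_, NeZero.ne n⟩, ?_⟩
    · simpa using addOrderOf_dvd_card (x := i)
    · have h0 := addOrderOf_pos i
      have h1 : addOrderOf i ≠ 1 := by simpa using hi
      omega

lemma cycleNumber_U_eq (q : (ZMod n)ˣ) (t : ZMod n) :
    cycleNumber (U n) (aut n q t) = cycleNumber (U n) (aut n q 0) := by
  have hq : IsCoprime ((q : ZMod n).val : ℤ) (n : ℤ) :=
    Nat.isCoprime_iff_coprime.2 (ZMod.val_coe_unit_coprime q)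
  have h : q = ZMod.unitOfIsCoprime _ hq := by ext; simp
  rw [h]
  have := (cycleNumber_U _ hq t).trans (cycleNumber_U _ hq 0).symm
  exact_mod_cast this

/-- The two automorphisms are conjugate under `aut n w 0`. -/
lemma cycleNumber_V_unit_mul (q w : (ZMod n)ˣ) (t : ZMod n) :
    cycleNumber (V n) (aut n q (w * t)) = cycleNumber (V n) (aut n q t) := by
  rw [← cycleNumber_conj (aut n q t) (aut n w 0) (V n) (aut_smul_mem_V _ _) (aut_smul_mem_V _ _)]
  congr 1
  rw [eq_mul_inv_iff_mul_eq, aut_mul, aut_mul, mul_comm q w]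
  simp

lemma exists_eq_unit_mul_gcd (t : ZMod n) : ∃ w : (ZMod n)ˣ, t = w * (n.gcd t.val : ℕ) := by
  obtain ⟨d, hd, w, hw, rfl⟩ := ZMod.eq_unit_mul_divisor t
  obtain ⟨w, rfl⟩ := hw
  refine ⟨w, ?_⟩
  congr 2
  have h : ((w : ZMod n) * (d : ZMod n)) = (((w : ZMod n).val * d : ℕ) : ZMod n) := by
    push_cast
    rw [ZMod.natCast_zmod_val]
  rw [h, ZMod.val_natCast, Nat.gcd_comm n, ← Nat.gcd_rec n, Nat.gcd_comm n,
    (ZMod.val_coe_unit_coprime w).gcd_mul_left_cancel, Nat.gcd_eq_left hd]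

/-- Every residue is a unit times its gcd with `n`, and `φ(n/d)` residues have gcd `d`. -/
lemma sum_zmod_eq_sum_divisors (f : ZMod n → ℚ)
    (hf : ∀ (w : (ZMod n)ˣ) (t : ZMod n), f (w * t) = f t) :
    ∑ t : ZMod n, f t = ∑ d ∈ n.divisors, ((n / d).totient : ℚ) * f (d : ZMod n) := by
  classical
  have hg : ∀ t : ZMod n, f t = f ((n.gcd t.val : ℕ) : ZMod n) := fun t => by
    obtain ⟨w, hw⟩ := exists_eq_unit_mul_gcd t
    conv_lhs => rw [hw]
    exact hf w _
  rw [← Finset.sum_fiberwise_of_maps_to (t := n.divisors) (g := fun t : ZMod n => n.gcd t.val)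
    (fun t _ => Nat.mem_divisors.2 ⟨Nat.gcd_dvd_left _ _, NeZero.ne n⟩)]
  refine Finset.sum_congr rfl fun d hd => ?_
  rw [Finset.sum_congr rfl (g := fun _ => f (d : ZMod n))
    (fun t ht => by rw [hg t, (Finset.mem_filter.1 ht).2]), Finset.sum_const, nsmul_eq_mul,
    Nat.totient_div_of_dvd (Nat.dvd_of_mem_divisors hd)]
  congr 2
  refine Finset.card_nbij' (fun t => t.val) (fun k => (k : ZMod n)) ?_ ?_ ?_ ?_
  · intro t ht
    simpa [ZMod.val_lt] using ht
  · intro k hk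
    simp only [Finset.coe_filter, Finset.mem_range, Set.mem_ofPred_eq] at hk
    simpa [ZMod.val_natCast_of_lt hk.1] using hk.2
  · intro t _
    simp
  · intro k hk
    simp only [Finset.coe_filter, Finset.mem_range, Set.mem_ofPred_eq] at hk
    exact ZMod.val_natCast_of_lt hk.1

lemma cycleNumber_compl_one (q : (ZMod n)ˣ) (t : ZMod n) :
    cycleNumber ({1}ᶜ : Set (DihedralGroup n)) (aut n q t) =
      cycleNumber (U n) (aut n q 0) + cycleNumber (V n) (aut n q t) := by
  rw [← cycleNumber_U_eq q t, ← U_union_V]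
  exact orbitNumber_union (smul_mem_of_zpowers (aut_smul_mem_U q t)) disjoint_U_V

lemma orbitNumber_connectionSets_dihedral (hn : 2 < n) :
    (orbitNumber (MulAut (DihedralGroup n)) (connectionSets (DihedralGroup n)) : ℚ) =
      1 / ((n : ℚ) * (n.totient : ℚ)) *
        ∑ t ∈ n.divisors, (Nat.totient (n / t) : ℚ) *
          ∑ q : (ZMod n)ˣ, (2 : ℚ) ^ (cycleNumber (U n) (aut n q 0) +
              cycleNumber (V n) (aut n q (t : ZMod n))) := by
  classical
  have : Fintype (MulAut (DihedralGroup n)) := Fintype.ofEquiv _ (autEquiv hn)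
  have h := orbitNumber_mul_card (G := MulAut (DihedralGroup n))
    (Set.toFinite (connectionSets (DihedralGroup n))).toFinset (fun g S hS => by
      rw [Set.Finite.mem_toFinset] at hS ⊢
      exact smul_mem_connectionSets g hS)
  have hcard : Fintype.card (MulAut (DihedralGroup n)) = n * n.totient := by
    rw [← Fintype.card_congr (autEquiv hn), Fintype.card_prod, ZMod.card_units_eq_totient,
      ZMod.card, mul_comm]
  rw [Set.Finite.coe_toFinset, hcard, ← (autEquiv hn).sum_comp, Fintype.sum_prod_type] at h
  have h1 : ∀ (q : (ZMod n)ˣ) (t : ZMod n),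
      (({S | S ∈ (Set.toFinite (connectionSets (DihedralGroup n))).toFinset ∧
        autEquiv hn (q, t) • S = S} : Set (Set (DihedralGroup n))).ncard : ℚ) =
      2 ^ (cycleNumber (U n) (aut n q 0) + cycleNumber (V n) (aut n q t)) := fun q t => by
    simp only [Set.Finite.mem_toFinset, autEquiv_apply, connectionSets]
    rw [ncard_fixed_subsets, cycleNumber_compl_one]
    · push_cast
      rfl
    · intro α
      simp [MulAut.smul_def]
  simp_rw [h1] at h
  have h2 : ∀ q : (ZMod n)ˣ, ∑ t : ZMod n,
      (2 : ℚ) ^ (cycleNumber (U n) (aut n q 0) + cycleNumber (V n) (aut n q t)) = _ := fun q =>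
    sum_zmod_eq_sum_divisors (fun t => (2 : ℚ) ^ (cycleNumber (U n) (aut n q 0) +
      cycleNumber (V n) (aut n q t))) fun w t => by simp only [cycleNumber_V_unit_mul]
  simp_rw [h2] at h
  rw [Finset.sum_comm] at h
  have hn0 : (n : ℚ) ≠ 0 := by exact_mod_cast NeZero.ne n
  have hphi : (n.totient : ℚ) ≠ 0 := by
    exact_mod_cast (Nat.totient_pos.2 (NeZero.pos n)).ne'
  simp_rw [← Finset.mul_sum] at h
  rw [← h]
  push_cast
  field_simp

end

/-! ### Arithmetic of `κ` and the count of exponents -/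

section Arithmetic

lemma dvd_pow_sub_one_iff (m : ℕ) (q : ℤ) (k : ℕ) : (m : ℤ) ∣ q ^ k - 1 ↔ ordMod q m ∣ k := by
  rw [ordMod, orderOf_dvd_iff_pow_eq_one, ← ZMod.intCast_zmod_eq_zero_iff_dvd]
  push_cast
  rw [sub_eq_zero]

lemma ordMod_pos {m : ℕ} (hm : 0 < m) {q : ℤ} (hq : IsCoprime q (m : ℤ)) : 0 < ordMod q m := by
  have : NeZero m := ⟨hm.ne'⟩
  have h := orderOf_pos (ZMod.unitOfIsCoprime q hq)
  rwa [← orderOf_units, ZMod.coe_unitOfIsCoprime] at h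

lemma ordMod_dvd_of_dvd {d n : ℕ} (h : d ∣ n) (q : ℤ) : ordMod q d ∣ ordMod q n :=
  (dvd_pow_sub_one_iff d q _).1
    ((Int.natCast_dvd_natCast.2 h).trans ((dvd_pow_sub_one_iff n q _).2 dvd_rfl))

/-- The sum is cut into `j` blocks of length `k`, each `x ^ k` times the preceding one. -/
lemma geomS_mul (k j : ℕ) (x : ℤ) : geomS (k * j) x = geomS k x * geomS j (x ^ k) := by
  induction j with
  | zero => simp [geomS]
  | succ j ih =>
    have h : geomS (k * j + k) x = geomS (k * j) x + (x ^ k) ^ j * geomS k x := by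
      simp only [geomS, Finset.sum_range_add, pow_add, Finset.mul_sum, pow_mul]
    rw [Nat.mul_succ, h, ih, geomS, geomS, geomS, Finset.sum_range_succ]
    ring

lemma geomS_mul_sub_one (k : ℕ) (x : ℤ) : geomS k x * (x - 1) = x ^ k - 1 :=
  geom_sum_mul x k

lemma dvd_geomS_sub {m : ℤ} {x : ℤ} (h : m ∣ x - 1) (j : ℕ) : m ∣ geomS j x - j := by
  have h1 : x ≡ 1 [ZMOD m] := (Int.modEq_iff_dvd.2 h).symm
  refine (Int.modEq_iff_dvd.1 ?_)
  have : geomS j x ≡ ∑ i ∈ Finset.range j, (1 : ℤ) [ZMOD m] :=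
    Int.ModEq.sum fun i _ => by simpa using h1.pow i
  simpa using this.symm

/-- `κ(m, q, t)` is the order of the affine permutation `x ↦ q x + t` modulo `m`. -/
lemma kappa_dvd_iff {m : ℕ} (hm : 0 < m) (q t : ℤ) (k : ℕ) :
    kappa m q t ∣ k ↔ (m : ℤ) ∣ q ^ k - 1 ∧ (m : ℤ) ∣ t * geomS k q := by
  set o := ordMod q m with ho
  set g := Int.gcd m (t * geomS o q) with hg
  have hgm : g ∣ m := Int.natCast_dvd_natCast.1 (Int.gcd_dvd_left _ _)
  have hgpos : 0 < g := Nat.pos_of_dvd_of_pos hgm hm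
  have hk : kappa m q t = o * (m / g) := by
    rw [kappa, ← ho, ← hg, mul_comm, Nat.mul_div_assoc _ hgm]
  rw [hk, dvd_pow_sub_one_iff, ← ho]
  -- Since `q ^ o ≡ 1` mod `m`, `S_{oj}(q) ≡ j S_o(q)`; the condition becomes linear in `j`.
  have key : ∀ j : ℕ, (m : ℤ) ∣ t * geomS (o * j) q ↔ m / g ∣ j := fun j => by
    have h1 : (m : ℤ) ∣ t * geomS (o * j) q - t * geomS o q * j := by
      rw [geomS_mul, ← mul_assoc, ← mul_sub]
      exact (dvd_geomS_sub ((dvd_pow_sub_one_iff m q o).2 dvd_rfl) j).mul_left _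
    rw [dvd_iff_dvd_of_dvd_sub h1, ← Int.dvd_gcd_mul_iff_dvd_mul, ← hg, ← Nat.cast_mul,
      Int.natCast_dvd_natCast]
    conv_lhs => rw [← Nat.mul_div_cancel' hgm]
    exact Nat.mul_dvd_mul_iff_left hgpos
  constructor
  · rintro ⟨j, rfl⟩
    refine ⟨⟨_, mul_assoc _ _ _⟩, ?_⟩
    rw [mul_assoc, key]
    exact dvd_mul_right _ _
  · rintro ⟨⟨j, rfl⟩, h⟩
    exact mul_dvd_mul_left _ ((key j).1 h)

lemma kappa_pos {m : ℕ} (hm : 0 < m) {q : ℤ} (hq : IsCoprime q (m : ℤ)) (t : ℤ) :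
    0 < kappa m q t := by
  refine Nat.div_pos (Nat.le_of_dvd (mul_pos hm (ordMod_pos hm hq)) ?_) ?_
  · exact (Int.natCast_dvd_natCast.1 (Int.gcd_dvd_left _ _)).mul_right _
  · exact Int.gcd_pos_of_ne_zero_left _ (by exact_mod_cast hm.ne')

lemma ordMod_dvd_kappa {m : ℕ} (hm : 0 < m) (q t : ℤ) : ordMod q m ∣ kappa m q t :=
  (dvd_pow_sub_one_iff m q _).1 ((kappa_dvd_iff hm q t _).1 dvd_rfl).1

lemma kappa_dvd_of_dvd {d n : ℕ} (hn : 0 < n) (h : d ∣ n) (q t : ℤ) :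
    kappa d q t ∣ kappa n q t := by
  have h1 := (kappa_dvd_iff hn q t _).1 dvd_rfl
  have hd : (d : ℤ) ∣ n := Int.natCast_dvd_natCast.2 h
  exact (kappa_dvd_iff (Nat.pos_of_dvd_of_pos h hn) q t _).2 ⟨hd.trans h1.1, hd.trans h1.2⟩

/-- A divisor `e` of `n` divides `q ^ k - 1` iff `|q|_e ∣ k`. As `|q|_e ∣ |q|_n`, only `gcd(k,
|q|_n)` matters. -/
lemma gcd_pow_sub_one_eq_of_gcd_eq {n : ℕ} (q : ℤ) {k k' : ℕ}
    (h : k.gcd (ordMod q n) = k'.gcd (ordMod q n)) :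
    Int.gcd (q ^ k - 1) n = Int.gcd (q ^ k' - 1) n := by
  have key : ∀ k k' : ℕ, k.gcd (ordMod q n) = k'.gcd (ordMod q n) →
      Int.gcd (q ^ k - 1) n ∣ Int.gcd (q ^ k' - 1) n := by
    intro k k' h
    set e := Int.gcd (q ^ k - 1) n
    have hen : e ∣ n := Int.natCast_dvd_natCast.1 (Int.gcd_dvd_right _ _)
    have hek : (e : ℤ) ∣ q ^ k - 1 := Int.gcd_dvd_left _ _
    have h1 : ordMod q e ∣ k' := by
      refine (h ▸ Nat.dvd_gcd ((dvd_pow_sub_one_iff e q k).1 hek) (ordMod_dvd_of_dvd hen q) :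
        ordMod q e ∣ k'.gcd (ordMod q n)).trans (Nat.gcd_dvd_left _ _)
    exact Int.natCast_dvd_natCast.1
      (Int.dvd_coe_gcd ((dvd_pow_sub_one_iff e q k').2 h1) (Int.natCast_dvd_natCast.2 hen))
  exact Nat.dvd_antisymm (key _ _ h) (key _ _ h.symm)

lemma gcd_dvd_iff_exists_linear (c b : ℤ) (n : ℕ) :
    (Int.gcd c n : ℤ) ∣ b ↔ ∃ x : ℤ, (n : ℤ) ∣ c * x - b := by
  constructor
  · rintro ⟨y, rfl⟩
    exact ⟨Int.gcdA c n * y, -(Int.gcdB c n * y), by rw [Int.gcd_eq_gcd_ab]; ring⟩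
  · rintro ⟨x, hx⟩
    have h := dvd_sub ((Int.gcd_dvd_left c n).mul_right x) ((Int.gcd_dvd_right c n).trans hx)
    rwa [sub_sub_cancel] at h

/-- If some power of the affine map has exactly `d > 0` fixed points, then its order is the least
common multiple of its order modulo `d` and of the order of `q`. -/
lemma kappa_eq_lcm {n d : ℕ} (hn : 0 < n) (hd : d ∣ n) (q t : ℤ) {k : ℕ}
    (hk : kappa d q t ∣ k) (hkd : Int.gcd (q ^ k - 1) n = d) :
    kappa n q t = (kappa d q t).lcm (ordMod q n) := by
  have hd0 := Nat.pos_of_dvd_of_pos hd hn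
  refine Nat.dvd_antisymm ?_ (Nat.lcm_dvd (kappa_dvd_of_dvd hn hd q t) (ordMod_dvd_kappa hn q t))
  set o := ordMod q n
  -- `k₀` divides `k` and has the same gcd with `o`, so its power also has `gcd(q ^ k₀ - 1, n) = d`;
  -- being a multiple of `κ(d)`, it makes this power have a fixed point `x` mod `n`.
  set k₀ := (kappa d q t).lcm (k.gcd o) with hk₀
  have hgcd : k₀.gcd o = k.gcd o := by
    refine Nat.dvd_antisymm (Nat.gcd_dvd_gcd_of_dvd_left _ (Nat.lcm_dvd hk (Nat.gcd_dvd_left _ _)))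
      (Nat.dvd_gcd (Nat.dvd_lcm_right _ _) (Nat.gcd_dvd_right _ _))
  rw [gcd_pow_sub_one_eq_of_gcd_eq q hgcd.symm] at hkd
  have hfix : (d : ℤ) ∣ t * geomS k₀ q :=
    ((kappa_dvd_iff hd0 q t k₀).1 (Nat.dvd_lcm_left _ _)).2
  rw [← hkd, gcd_dvd_iff_exists_linear] at hfix
  obtain ⟨x, hx⟩ := hfix
  have hL : k₀ ∣ (kappa d q t).lcm o :=
    Nat.lcm_dvd (Nat.dvd_lcm_left _ _) ((Nat.gcd_dvd_right _ _).trans (Nat.dvd_lcm_right _ _))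
  have hq : (n : ℤ) ∣ q ^ (kappa d q t).lcm o - 1 :=
    (dvd_pow_sub_one_iff n q _).2 (Nat.dvd_lcm_right _ _)
  rw [kappa_dvd_iff hn]
  refine ⟨hq, ?_⟩
  obtain ⟨j, hj⟩ := hL
  rw [hj] at hq ⊢
  have h1 := geomS_mul_sub_one j (q ^ k₀)
  -- With `k₀ * j` the lcm, the corresponding power still fixes `x` mod `n` and, as `q ^ (k₀ * j) ≡
  -- 1`, is a translation; hence it is the identity.
  have h2 : t * geomS (k₀ * j) q =
      (q ^ (k₀ * j) - 1) * x - ((q ^ k₀ - 1) * x - t * geomS k₀ q) * geomS j (q ^ k₀) := by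
    rw [geomS_mul, pow_mul, ← h1]
    ring
  rw [h2]
  exact dvd_sub (hq.mul_right _) (hx.mul_right _)

lemma gcd_mul_eq_gcd_mul_gcd_div (a o j : ℕ) (ho : 0 < o) :
    (j * a).gcd o = a.gcd o * j.gcd (o / a.gcd o) := by
  obtain ⟨g, hgdef⟩ : ∃ g, a.gcd o = g := ⟨_, rfl⟩
  have hg : 0 < a.gcd o := Nat.gcd_pos_of_pos_right _ ho
  have hc := Nat.coprime_div_gcd_div_gcd hg
  obtain ⟨a', ha⟩ := Nat.gcd_dvd_left a o
  obtain ⟨N, hN⟩ := Nat.gcd_dvd_right a o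
  rw [Nat.div_eq_of_eq_mul_right hg ha, Nat.div_eq_of_eq_mul_right hg hN] at hc
  rw [Nat.div_eq_of_eq_mul_right hg hN]
  rw [hgdef] at ha hN ⊢
  rw [ha, hN, show j * (g * a') = g * (j * a') by ring, Nat.gcd_mul_left,
    hc.gcd_mul_right_cancel]

/-- The number of exponents modulo `κ(n, q, t)` for which the power of the affine map has exactly
`d` fixed points. -/
lemma card_exponents_eq {n d : ℕ} (hn : 0 < n) (hd : d ∣ n) (q t : ℤ)
    (hq : IsCoprime q (n : ℤ)) :
    ((Finset.range (kappa n q t)).filter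
        fun k => Int.gcd (q ^ k - 1) n = d ∧ kappa d q t ∣ k).card =
      ∑ l ∈ (ordMod q n / Nat.gcd (kappa d q t) (ordMod q n)).divisors with
        Int.gcd (q ^ (l * kappa d q t) - 1) n = d,
        Nat.totient (ordMod q n / (l * Nat.gcd (kappa d q t) (ordMod q n))) := by
  classical
  have hd0 := Nat.pos_of_dvd_of_pos hd hn
  have ho := ordMod_pos hn hq
  have hκ : 0 < kappa d q t :=
    kappa_pos hd0 (hq.of_isCoprime_of_dvd_right (Int.natCast_dvd_natCast.2 hd)) t
  by_cases hex : ∃ k, kappa d q t ∣ k ∧ Int.gcd (q ^ k - 1) n = d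
  · obtain ⟨k, hk, hkd⟩ := hex
    have hlcm := kappa_eq_lcm hn hd q t hk hkd
    set κ := kappa d q t
    set o := ordMod q n with ho'
    have hg : 0 < κ.gcd o := Nat.gcd_pos_of_pos_right _ ho
    set N := o / κ.gcd o with hN
    have hN0 : 0 < N := Nat.div_pos (Nat.le_of_dvd ho (Nat.gcd_dvd_right _ _)) hg
    have hK : kappa n q t = N * κ := by
      rw [hlcm, Nat.lcm, Nat.mul_div_assoc _ (Nat.gcd_dvd_right _ _), mul_comm]
    -- The identity `gcd(jκ, o) = gcd(κ, o) gcd(j, N)` shows that only `gcd(N, j)` matters.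
    have hG : ∀ j, Int.gcd (q ^ (j * κ) - 1) n = Int.gcd (q ^ (N.gcd j * κ) - 1) n := fun j => by
      refine gcd_pow_sub_one_eq_of_gcd_eq q ?_
      rw [← ho', gcd_mul_eq_gcd_mul_gcd_div _ _ _ ho, gcd_mul_eq_gcd_mul_gcd_div _ _ _ ho, ← hN,
        Nat.gcd_comm N j, Nat.gcd_assoc, Nat.gcd_self]
    have h1 : ((Finset.range (kappa n q t)).filter
        fun k => Int.gcd (q ^ k - 1) n = d ∧ κ ∣ k) =
        ((Finset.range N).filter fun j => Int.gcd (q ^ (N.gcd j * κ) - 1) n = d).image (· * κ) := by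
      ext k
      simp only [Finset.mem_filter, Finset.mem_range, Finset.mem_image, hK]
      constructor
      · rintro ⟨hlt, hgcd, j, rfl⟩
        rw [mul_comm κ j] at hlt hgcd
        exact ⟨j, ⟨lt_of_mul_lt_mul_right hlt (Nat.zero_le _), by rw [← hG, hgcd]⟩, mul_comm _ _⟩
      · rintro ⟨j, ⟨hlt, hgcd⟩, rfl⟩
        exact ⟨Nat.mul_lt_mul_of_pos_right hlt hκ, by rw [hG, hgcd], dvd_mul_left _ _⟩
    rw [h1, Finset.card_image_of_injective _ (fun a b h => Nat.eq_of_mul_eq_mul_right hκ h),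
      Finset.card_eq_sum_card_fiberwise (f := fun j => N.gcd j)
        (t := N.divisors.filter fun l => Int.gcd (q ^ (l * κ) - 1) n = d)]
    · refine Finset.sum_congr rfl fun l hl => ?_
      rw [Finset.mem_filter, Nat.mem_divisors] at hl
      rw [mul_comm l, ← Nat.div_div_eq_div_mul, ← hN, Nat.totient_div_of_dvd hl.1.1,
        Finset.filter_filter]
      congr 1
      refine Finset.filter_congr fun j _ => ?_
      refine ⟨fun h => h.2, fun h => ⟨by rw [h, hl.2], h⟩⟩
    · intro j hj
      have hj := (Finset.mem_filter.1 hj).2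
      exact Finset.mem_filter.2 ⟨Nat.mem_divisors.2 ⟨Nat.gcd_dvd_left _ _, hN0.ne'⟩, hj⟩
  -- With no admissible exponent at all, both sides are empty.
  · rw [Finset.filter_eq_empty_iff.2 fun k _ h => hex ⟨k, h.2, h.1⟩,
      Finset.filter_eq_empty_iff.2 fun l _ h => hex ⟨_, dvd_mul_left _ l, h⟩]
    simp

end Arithmetic

/-! ### Fixed points and cycles on reflections -/

section

variable {n : ℕ} [NeZero n]

/-- A nonempty solution set is a coset of the kernel of multiplication by `c`, which has `gcd(c, n)`
elements; the sign of `c` does not affect the kernel. -/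
lemma ncard_linear_solutions (c b : ℤ) :
    {i : ZMod n | (c : ZMod n) * i = b}.ncard =
      if (Int.gcd c n : ℤ) ∣ b then Int.gcd c n else 0 := by
  split_ifs with h
  · obtain ⟨x, hx⟩ := (gcd_dvd_iff_exists_linear c b n).1 h
    have hx : (c : ZMod n) * x = b := by
      rw [← sub_eq_zero]
      exact_mod_cast (ZMod.intCast_zmod_eq_zero_iff_dvd _ n).2 hx
    have hker := IsAddCyclic.card_nsmulAddMonoidHom_ker (G := ZMod n) c.natAbs
    rw [Nat.card_zmod, Nat.gcd_comm] at hker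
    have hgcd : Int.gcd c n = c.natAbs.gcd n := rfl
    rw [hgcd, ← hker]
    refine (Nat.card_coe_set_eq _).symm.trans (Nat.card_congr ?_)
    have hz : ∀ i : ZMod n, (c : ZMod n) * i = 0 ↔ c.natAbs • i = 0 := fun i => by
      rw [← zsmul_eq_mul]
      rcases Int.natAbs_eq c with hc | hc
      · conv_lhs => rw [hc, natCast_zsmul]
      · conv_lhs => rw [hc, neg_zsmul, natCast_zsmul, neg_eq_zero]
    refine (Equiv.subRight (x : ZMod n)).subtypeEquiv fun i => ?_
    rw [AddMonoidHom.mem_ker]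
    change _ ↔ c.natAbs • (i - (x : ZMod n)) = 0
    rw [← hz, mul_sub, hx, sub_eq_zero]
    rfl
  · rw [Set.ncard_eq_zero (Set.toFinite _), Set.eq_empty_iff_forall_notMem]
    intro i hi
    obtain ⟨x, rfl⟩ := ZMod.intCast_surjective i
    refine h ((gcd_dvd_iff_exists_linear c b n).2 ⟨x, ?_⟩)
    rw [← ZMod.intCast_zmod_eq_zero_iff_dvd]
    push_cast
    rw [sub_eq_zero]
    exact hi

lemma ncard_fixed_V (q t : ℤ) (hq : IsCoprime q (n : ℤ)) (k : ℕ) :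
    {g | g ∈ V n ∧ aut n (ZMod.unitOfIsCoprime q hq) t ^ k • g = g}.ncard =
      if kappa (Int.gcd (q ^ k - 1) n) q t ∣ k then Int.gcd (q ^ k - 1) n else 0 := by
  have hpos : 0 < Int.gcd (q ^ k - 1) n :=
    Int.gcd_pos_of_ne_zero_right _ (by exact_mod_cast NeZero.ne n)
  have h1 : {g | g ∈ V n ∧ aut n (ZMod.unitOfIsCoprime q hq) t ^ k • g = g} =
      sr '' {i : ZMod n | ((q ^ k - 1 : ℤ) : ZMod n) * i = (t * geomS k q : ℤ)} := by
    ext g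
    simp only [Set.mem_image, Set.mem_ofPred_eq, mem_V_iff]
    have h2 : ∀ i : ZMod n, aut n (ZMod.unitOfIsCoprime q hq) t ^ k • (sr i : DihedralGroup n) = sr i
        ↔ ((q ^ k - 1 : ℤ) : ZMod n) * i = (t * geomS k q : ℤ) := fun i => by
      rw [aut_pow, MulAut.smul_def, aut_sr, sr.injEq]
      simp only [geomS]
      push_cast
      rw [ZMod.coe_unitOfIsCoprime]
      constructor <;> intro h <;> linear_combination h
    constructor
    · rintro ⟨⟨i, rfl⟩, h⟩
      exact ⟨i, (h2 i).1 h, rfl⟩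
    · rintro ⟨i, h, rfl⟩
      exact ⟨⟨i, rfl⟩, (h2 i).2 h⟩
  rw [h1, Set.ncard_image_of_injective _ (fun _ _ h => sr.inj h), ncard_linear_solutions]
  -- For the modulus `gcd(q ^ k - 1, n)` the first condition of `kappa_dvd_iff` is automatic, so `κ
  -- ∣ k` is precisely solvability.
  refine if_congr ?_ rfl rfl
  rw [kappa_dvd_iff hpos]
  exact ⟨fun h => ⟨Int.gcd_dvd_left _ _, h⟩, fun h => h.2⟩

lemma orderOf_aut (q t : ℤ) (hq : IsCoprime q (n : ℤ)) :
    orderOf (aut n (ZMod.unitOfIsCoprime q hq) t) = kappa n q t := by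
  refine Nat.dvd_right_iff_eq.1 fun k => ?_
  rw [orderOf_dvd_iff_pow_eq_one, aut_pow, aut_eq_one_iff, kappa_dvd_iff (NeZero.pos n),
    ← ZMod.intCast_zmod_eq_zero_iff_dvd, ← ZMod.intCast_zmod_eq_zero_iff_dvd, Units.ext_iff]
  simp only [geomS]
  push_cast
  rw [ZMod.coe_unitOfIsCoprime, sub_eq_zero]

lemma cycleNumber_V (q t : ℤ) (hq : IsCoprime q (n : ℤ)) :
    (cycleNumber (V n) (aut n (ZMod.unitOfIsCoprime q hq) (t : ZMod n)) : ℚ) =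
      cVFormula n q t := by
  classical
  have hn := NeZero.pos n
  have h := cycleNumber_mul_orderOf (aut n (ZMod.unitOfIsCoprime q hq) t)
    (Set.toFinite (V n)).toFinset (by simpa using aut_smul_mem_V _ _)
  simp only [Set.Finite.coe_toFinset, Set.Finite.mem_toFinset, ncard_fixed_V, orderOf_aut] at h
  have hκ : (kappa n q t : ℚ) ≠ 0 := by exact_mod_cast (kappa_pos hn hq t).ne'
  refine mul_right_cancel₀ hκ (h.trans ?_)
  -- The exponents are grouped by `d = gcd(q ^ k - 1, n)`; each one in the group contributes `d` or
  -- `0`.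
  rw [cVFormula, Finset.sum_mul, ← Finset.sum_fiberwise_of_maps_to (t := n.divisors)
    (g := fun k => Int.gcd (q ^ k - 1) n) (fun k _ => Nat.mem_divisors.2
      ⟨Int.natCast_dvd_natCast.1 (Int.gcd_dvd_right _ _), hn.ne'⟩)]
  refine Finset.sum_congr rfl fun d hd => ?_
  rw [← Finset.mul_sum]
  have hcard := congrArg (Nat.cast : ℕ → ℚ)
    (card_exponents_eq hn (Nat.dvd_of_mem_divisors hd) q t hq)
  rw [Nat.cast_sum] at hcard
  rw [← hcard, ← Finset.filter_filter, Finset.card_filter]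
  rw [Finset.sum_congr rfl (g := fun k => if kappa d q t ∣ k then (d : ℚ) else 0)
    (fun k hk => by rw [(Finset.mem_filter.1 hk).2]; push_cast; rfl)]
  push_cast
  rw [div_mul_eq_mul_div, div_mul_cancel₀ _ hκ, Finset.mul_sum]
  simp

end

end CayleyEnum

theorem mainTheorem2 (n : ℕ) [NeZero n] (hn : 2 < n)
    (hDCI : CayleyEnum.IsDCIGroup (DihedralGroup n)) :
    CayleyEnum.numCayleyDigraphs (DihedralGroup n) =
      CayleyEnum.orbitNumber (MulAut (DihedralGroup n))
        (CayleyEnum.connectionSets (DihedralGroup n)) ∧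
    (CayleyEnum.orbitNumber (MulAut (DihedralGroup n))
        (CayleyEnum.connectionSets (DihedralGroup n)) : ℚ) =
      1 / ((n : ℚ) * (n.totient : ℚ)) *
        ∑ t ∈ n.divisors, (Nat.totient (n / t) : ℚ) *
          ∑ q : (ZMod n)ˣ,
            (2 : ℚ) ^ (CayleyEnum.cycleNumber (CayleyEnum.U n) (CayleyEnum.aut n q 0) +
              CayleyEnum.cycleNumber (CayleyEnum.V n) (CayleyEnum.aut n q (t : ZMod n))) ∧
    (∀ (q : ℤ) (hq : IsCoprime q (n : ℤ)),
      (CayleyEnum.cycleNumber (CayleyEnum.U n)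
          (CayleyEnum.aut n (ZMod.unitOfIsCoprime q hq) 0) : ℚ) =
        CayleyEnum.cUFormula n q) ∧
    (∀ (q t : ℤ) (hq : IsCoprime q (n : ℤ)),
      (CayleyEnum.cycleNumber (CayleyEnum.V n)
          (CayleyEnum.aut n (ZMod.unitOfIsCoprime q hq) (t : ZMod n)) : ℚ) =
        CayleyEnum.cVFormula n q t) := by
  exact ⟨CayleyEnum.numCayleyDigraphs_eq_orbitNumber hDCI,
    CayleyEnum.orbitNumber_connectionSets_dihedral hn,
    fun q hq => CayleyEnum.cycleNumber_U q hq 0,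
    fun q t hq => CayleyEnum.cycleNumber_V q t hq⟩
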